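/- An oracle assigns to each function $f:\mathbb{R}\to\mathbb{R}$ and each point $x\in\mathbb{R}$ a response $\mathbb{O}_f(x)$ in some (arbitrary) set; it is \emph{local} if $\mathbb{O}_f(x)=\mathbb{O}_g(x)$ whenever $f$ and $g$ agree on a neighborhood of $x$. A (possibly randomized) algorithm $\mathcal{A}$ interacting with $\mathbb{O}$ draws a random seed $\xi$ from an arbitrary probability space and, on the objective $f$, produces the iterates $x_t^{\mathcal{A}(f)}=\mathcal{A}^{(t)}\big(\xi,\mathbb{O}_f(x_1^{\mathcal{A}(f)}),\dots,\mathbb{O}_f(x_{t-1}^{\mathcal{A}(f)})\big)\in\mathbb{R}$, $t=1,2,\dots$, where the $\mathcal{A}^{(t)}$ are arbitrary maps such that, for every Lipschitz $f$ bounded from below, the iterates are random variables. For a Lipschitz function $h:\mathbb{R}\to\mathbb{R}$, let $\partial h(x)$ be the set of Clarke generalized derivatives of $h$ at $x$, that is, the convex hull of all limits $\lim_k h'(x_k)$ over sequences $x_k\to x$ of points at which $h$ is differentiable. \textbf{Proposition.} For every $T\in\mathbb{N}$ and every $\delta>0$ there is $\rho=\rho(T,\delta)>0$, depending only on $T$ and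 $\delta$, such that for every local oracle and every algorithm $\mathcal{A}$ interacting with it there exist a function $h:\mathbb{R}\to[0,\infty)$ and a point $x^*\in(0,1)$ with the following properties: \begin{itemize} \item $h$ is $2$-Lipschitz, $h(0)=1$, and $x^*$ is the unique global minimizer of $h$; \item for all $x\neq x^*$ and all $g\in\partial h(x)$, $|g|\geq 1$; \item the first $T$ iterates of $\mathcal{A}$ on $h$ satisfy $\Pr\big[\exists\, t\in\{1,\dots,T\}:\ |x_t^{\mathcal{A}(h)}-x^*|<\rho\big]<\delta$. \end{itemize} -/

import Mathlib

open Filter Topology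

/-- The Clarke generalized derivative (as a set) of a Lipschitz function `f : ℝ → ℝ` at `x`: the
convex hull of all limits of `f' (x k)` along sequences `x k → x` of differentiability points. -/
def clarkeDeriv (f : ℝ → ℝ) (x : ℝ) : Set ℝ :=
  convexHull ℝ {u : ℝ | ∃ s : ℕ → ℝ, (∀ k, DifferentiableAt ℝ f (s k)) ∧
    Tendsto s atTop (𝓝 x) ∧ Tendsto (fun k => deriv f (s k)) atTop (𝓝 u)}

/-- An oracle with responses in `R` (`O f x` is the response at the point `x` for the objective
`f`) is local if its response at `x` is the same for any two functions which agree on some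
neighborhood of `x`. -/
def IsLocalOracle {R : Type*} (O : (ℝ → ℝ) → ℝ → R) : Prop :=
  ∀ (x : ℝ) (f g : ℝ → ℝ), f =ᶠ[𝓝 x] g → O f x = O g x

/-- The iterates produced on the objective `f` by the algorithm whose `t`-th query rule `A t` maps
the responses to all the previous queries to the next query. Indices start at `0`, so the first
`T` iterates are those with index `t < T`. Randomized algorithms are handled by letting `A` depend
on a random seed. -/
def iterates {R : Type*} (O : (ℝ → ℝ) → ℝ → R) (A : (t : ℕ) → (Fin t → R) → ℝ) (f : ℝ → ℝ) :
    ℕ → ℝ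
  | t => A t (fun i : Fin t => O f (iterates O A f i))

/-! The hard functions are indexed by words of length `T` over `N` letters. Each letter selects one
of `N` disjoint subintervals of the current cell, and letters of index at least `k` affect the
function only inside the depth-`k` cell (`nested_eq_of_notMem_cell`), so a local oracle queried
outside that cell says nothing about them.

Fix the seed. While each query `s < t` misses the cell of depth `s + 1`, query `t` depends only on
the first `t` letters (`iterates_nested_eq`), so it can enter the cell of depth `t + 1` for only one
value of letter `t` (`eq_of_mem_cell_succ`). Hence a first entry at time `t` occurs for at most a
fraction `1 / N` of the words, and the final cell is entered for at most a fraction `T / N`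
(`card_mul_le`). Averaging over the seed gives one word that is hit with probability at most `T / N
< δ`.

Slope bounds in difference form survive gluing and rescaling; they yield the Lipschitz, minimizer
and Clarke claims. -/

/-! ### Steep functions and Clarke derivatives -/

/-- `f` decreases on `s` with slopes between `-2` and `-1`. -/
def SteepDecrOn (f : ℝ → ℝ) (s : Set ℝ) : Prop :=
  ∀ x ∈ s, ∀ y ∈ s, x ≤ y → y - x ≤ f x - f y ∧ f x - f y ≤ 2 * (y - x)

/-- `f` increases on `s` with slopes between `1` and `2`. -/
def SteepIncrOn (f : ℝ → ℝ) (s : Set ℝ) : Prop :=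
  ∀ x ∈ s, ∀ y ∈ s, x ≤ y → y - x ≤ f y - f x ∧ f y - f x ≤ 2 * (y - x)

theorem SteepDecrOn.glue {f : ℝ → ℝ} {s t u : Set ℝ} {m : ℝ} (hs : SteepDecrOn f s)
    (ht : SteepDecrOn f t) (hms : m ∈ s) (hmt : m ∈ t) (hu : ∀ x ∈ u, x ≤ m → x ∈ s)
    (hu' : ∀ x ∈ u, m ≤ x → x ∈ t) : SteepDecrOn f u := by
  intro x hx y hy hxy
  rcases le_total y m with h | h
  · exact hs x (hu x hx (hxy.trans h)) y (hu y hy h) hxy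
  rcases le_total m x with h' | h'
  · exact ht x (hu' x hx h') y (hu' y hy h) hxy
  · have h1 := hs x (hu x hx h') m hms h'
    have h2 := ht m hmt y (hu' y hy h) h
    constructor <;> linarith

theorem SteepIncrOn.glue {f : ℝ → ℝ} {s t u : Set ℝ} {m : ℝ} (hs : SteepIncrOn f s)
    (ht : SteepIncrOn f t) (hms : m ∈ s) (hmt : m ∈ t) (hu : ∀ x ∈ u, x ≤ m → x ∈ s)
    (hu' : ∀ x ∈ u, m ≤ x → x ∈ t) : SteepIncrOn f u := by
  intro x hx y hy hxy
  rcases le_total y m with h | h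
  · exact hs x (hu x hx (hxy.trans h)) y (hu y hy h) hxy
  rcases le_total m x with h' | h'
  · exact ht x (hu' x hx h') y (hu' y hy h) hxy
  · have h1 := hs x (hu x hx h') m hms h'
    have h2 := ht m hmt y (hu' y hy h) h
    constructor <;> linarith

theorem lipschitzWith_two_of_steep {f : ℝ → ℝ} {c : ℝ} (hd : SteepDecrOn f (Set.Iic c))
    (hi : SteepIncrOn f (Set.Ici c)) : LipschitzWith 2 f := by
  have key : ∀ x y, x ≤ y → |f x - f y| ≤ 2 * (y - x) := by
    intro x y hxy
    rw [abs_le]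
    rcases le_total y c with h | h
    · have := hd x (hxy.trans h) y h hxy
      constructor <;> linarith
    rcases le_total c x with h' | h'
    · have := hi x h' y h hxy
      constructor <;> linarith
    · have h1 := hd x h' c Set.self_mem_Iic h'
      have h2 := hi c Set.self_mem_Ici y h h
      constructor <;> linarith
  refine LipschitzWith.of_dist_le_mul fun x y => ?_
  simp only [Real.dist_eq, NNReal.coe_ofNat]
  rcases le_total x y with h | h
  · rw [abs_sub_comm x y, abs_of_nonneg (sub_nonneg.2 h)]
    exact key x y h
  · rw [abs_sub_comm (f x), abs_of_nonneg (sub_nonneg.2 h)]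
    exact key y x h

theorem lt_of_steep {f : ℝ → ℝ} {c : ℝ} (hd : SteepDecrOn f (Set.Iic c))
    (hi : SteepIncrOn f (Set.Ici c)) {x : ℝ} (hx : x ≠ c) : f c < f x := by
  rcases lt_or_gt_of_ne hx with h | h
  · linarith [(hd x h.le c Set.self_mem_Iic h.le).1]
  · linarith [(hi c Set.self_mem_Ici x h.le h.le).1]

theorem SteepDecrOn.deriv_le {f : ℝ → ℝ} {c x : ℝ} (hd : SteepDecrOn f (Set.Iic c)) (hx : x < c)
    (hf : DifferentiableAt ℝ f x) : deriv f x ≤ -1 := by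
  have hanti : AntitoneOn (fun y => f y + y) (Set.Iio c) := fun a ha b hb hab => by
    have := (hd a (Set.Iio_subset_Iic_self ha) b (Set.Iio_subset_Iic_self hb) hab).1
    simp only
    linarith
  have h := hanti.derivWithin_nonpos (x := x)
  rw [derivWithin_of_isOpen isOpen_Iio hx,
    (hf.hasDerivAt.fun_add (hasDerivAt_id' x)).deriv] at h
  linarith

theorem SteepIncrOn.le_deriv {f : ℝ → ℝ} {c x : ℝ} (hi : SteepIncrOn f (Set.Ici c)) (hx : c < x)
    (hf : DifferentiableAt ℝ f x) : 1 ≤ deriv f x := by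
  have hmono : MonotoneOn (fun y => f y - y) (Set.Ioi c) := fun a ha b hb hab => by
    have := (hi a (Set.Ioi_subset_Ici_self ha) b (Set.Ioi_subset_Ici_self hb) hab).1
    simp only
    linarith
  have h := hmono.derivWithin_nonneg (x := x)
  rw [derivWithin_of_isOpen isOpen_Ioi hx,
    (hf.hasDerivAt.fun_sub (hasDerivAt_id' x)).deriv] at h
  linarith

/-- Differentiability points close to `x` lie on the same side of `c`, and the half-line containing
their derivatives is closed and convex, so it absorbs both the limits and the hull. -/
theorem one_le_abs_of_mem_clarkeDeriv {f : ℝ → ℝ} {c : ℝ} (hd : SteepDecrOn f (Set.Iic c))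
    (hi : SteepIncrOn f (Set.Ici c)) {x : ℝ} (hx : x ≠ c) {g : ℝ} (hg : g ∈ clarkeDeriv f x) :
    1 ≤ |g| := by
  rcases lt_or_gt_of_ne hx with h | h
  · have hsub : clarkeDeriv f x ⊆ Set.Iic (-1) := by
      refine convexHull_min ?_ (convex_Iic _)
      rintro u ⟨s, hs, hsx, hu⟩
      exact le_of_tendsto hu
        ((hsx.eventually_lt_const h).mono fun k hk => hd.deriv_le hk (hs k))
    have h1 : g ≤ -1 := hsub hg
    rw [abs_of_neg (by linarith)]
    linarith
  · have hsub : clarkeDeriv f x ⊆ Set.Ici 1 := by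
      refine convexHull_min ?_ (convex_Ici _)
      rintro u ⟨s, hs, hsx, hu⟩
      exact ge_of_tendsto hu
        ((hsx.eventually_const_lt h).mono fun k hk => hi.le_deriv hk (hs k))
    exact (show 1 ≤ g from hsub hg).trans (le_abs_self g)

/-! ### Construction of the nested family -/

section NestedFamily

variable {N : ℕ}

/-- The ratio of the lengths of consecutive nested intervals. -/
noncomputable def ratio (N : ℕ) : ℝ := 1 / (6 * N)

/-- The left end of the `i`-th of the `N` disjoint subintervals of length `ratio N` of the middle
third of `[0, 1]`. -/
noncomputable def leftEnd (i : Fin N) : ℝ := 1 / 3 + (2 * i + 1 / 2) * ratio N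

/-- The distance from the right end of the `i`-th subinterval to `1`. -/
noncomputable def rightGap (i : Fin N) : ℝ := 1 - leftEnd i - ratio N

/-- The amount by which a member of the family falls from `[0, 1]` to the `i`-th subinterval. -/
noncomputable def drop (i : Fin N) : ℝ := max (leftEnd i) (rightGap i)

/-- The nested family: the function of depth `0` is V-shaped, and the function of depth `n + 1`
descends from both ends of `[0, 1]` to the subinterval selected by the first letter of the word,
on which it is a rescaled function of depth `n`. -/
noncomputable def nested : ℕ → (ℕ → Fin N) → ℝ → ℝ
  | 0, _, x => max (1 - x) x
  | n + 1, w, x =>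
    if x < leftEnd (w 0) then min (1 - x) (1 - drop (w 0) / leftEnd (w 0) * x)
    else if x ≤ leftEnd (w 0) + ratio N then
      1 - drop (w 0) +
        ratio N * (nested n (fun k => w (k + 1)) ((x - leftEnd (w 0)) / ratio N) - 1)
    else min x (1 - drop (w 0) / rightGap (w 0) * (1 - x))

/-- The left end of the interval of depth `k`, of length `ratio N ^ k`, selected by a word. -/
noncomputable def cellLeft : ℕ → (ℕ → Fin N) → ℝ
  | 0, _ => 0
  | k + 1, w => leftEnd (w 0) + ratio N * cellLeft k (fun j => w (j + 1))

/-- The interval of depth `k` selected by a word. -/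
noncomputable def cell (k : ℕ) (w : ℕ → Fin N) : Set ℝ :=
  Set.Icc (cellLeft k w) (cellLeft k w + ratio N ^ k)

/-- The minimizer of `nested n w`: the midpoint of the cell of depth `n`. -/
noncomputable def nestedMin (n : ℕ) (w : ℕ → Fin N) : ℝ := cellLeft n w + ratio N ^ n / 2

theorem ratio_pos (hN : 0 < N) : 0 < ratio N := by
  unfold ratio
  positivity

theorem natCast_mul_ratio (hN : 0 < N) : N * ratio N = 1 / 6 := by
  unfold ratio
  field_simp

theorem third_le_leftEnd (i : Fin N) : 1 / 3 ≤ leftEnd i := by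
  have := ratio_pos i.pos
  unfold leftEnd
  have : 0 ≤ (2 * (i : ℝ) + 1 / 2) * ratio N := by positivity
  linarith

theorem third_le_rightGap (i : Fin N) : 1 / 3 ≤ rightGap i := by
  have hr := ratio_pos i.pos
  have hN := natCast_mul_ratio i.pos
  have hi : (i : ℝ) + 1 ≤ N := by exact_mod_cast i.2
  unfold rightGap leftEnd
  nlinarith

theorem leftEnd_add_rightGap (i : Fin N) : leftEnd i + ratio N + rightGap i = 1 := by
  unfold rightGap
  ring

/-- Both descents have length at least 1/3 and together less than 1, so neither is more than twice
the other. -/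
theorem drop_div_mem {i : Fin N} {a : ℝ} (ha : a = leftEnd i ∨ a = rightGap i) :
    1 ≤ drop i / a ∧ drop i / a ≤ 2 := by
  have h1 := third_le_leftEnd i
  have h2 := third_le_rightGap i
  have h3 := leftEnd_add_rightGap i
  have h4 := ratio_pos i.pos
  have ha0 : 0 < a := by rcases ha with rfl | rfl <;> linarith
  rw [le_div_iff₀ ha0, div_le_iff₀ ha0, one_mul]
  unfold drop
  constructor
  · rcases ha with rfl | rfl
    · exact le_max_left _ _
    · exact le_max_right _ _
  · apply max_le <;> rcases ha with rfl | rfl <;> linarith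

theorem cellLeft_bounds (hN : 0 < N) (k : ℕ) (w : ℕ → Fin N) :
    0 ≤ cellLeft k w ∧ cellLeft k w + ratio N ^ k ≤ 1 := by
  induction k generalizing w with
  | zero => simp [cellLeft]
  | succ k ih =>
    have hr := ratio_pos hN
    obtain ⟨h1, h2⟩ := ih fun j => w (j + 1)
    have h3 := third_le_leftEnd (w 0)
    have h4 := third_le_rightGap (w 0)
    have h5 := leftEnd_add_rightGap (w 0)
    have h6 := mul_le_mul_of_nonneg_left h2 hr.le
    have h7 := mul_nonneg hr.le h1
    simp only [cellLeft, pow_succ]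
    constructor <;> linarith

theorem nestedMin_mem_Ioo (hN : 0 < N) (n : ℕ) (w : ℕ → Fin N) :
    nestedMin n w ∈ Set.Ioo (0 : ℝ) 1 := by
  have h := cellLeft_bounds hN n w
  have hr := pow_pos (ratio_pos hN) n
  unfold nestedMin
  constructor <;> linarith [h.1, h.2]

theorem nestedMin_succ (n : ℕ) (w : ℕ → Fin N) :
    nestedMin (n + 1) w = leftEnd (w 0) + ratio N * nestedMin n (fun k => w (k + 1)) := by
  simp only [nestedMin, cellLeft]
  ring

/-- The `min` in the definition keeps slope `-1` here whatever the word: this starts the locality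
induction and makes rescaled copies fit at their ends. -/
theorem nested_of_nonpos (n : ℕ) (w : ℕ → Fin N) {x : ℝ} (hx : x ≤ 0) :
    nested n w x = 1 - x := by
  cases n with
  | zero => exact max_eq_left (by linarith)
  | succ n =>
    have h1 := third_le_leftEnd (w 0)
    have h2 := (drop_div_mem (Or.inl rfl : leftEnd (w 0) = leftEnd (w 0) ∨ _)).1
    rw [nested, if_pos (by linarith)]
    exact min_eq_left (by nlinarith)

theorem nested_of_one_le (n : ℕ) (w : ℕ → Fin N) {x : ℝ} (hx : 1 ≤ x) : nested n w x = x := by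
  cases n with
  | zero => exact max_eq_right (by linarith)
  | succ n =>
    have h1 := third_le_rightGap (w 0)
    have h2 := (drop_div_mem (Or.inr rfl : rightGap (w 0) = leftEnd (w 0) ∨ _)).1
    have h3 := leftEnd_add_rightGap (w 0)
    have h4 := ratio_pos (w 0).pos
    rw [nested, if_neg (by linarith), if_neg (by linarith)]
    exact min_eq_left (by nlinarith)

theorem nested_succ_of_le_leftEnd (n : ℕ) (w : ℕ → Fin N) {x : ℝ} (hx : x ≤ leftEnd (w 0)) :
    nested (n + 1) w x = min (1 - x) (1 - drop (w 0) / leftEnd (w 0) * x) := by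
  rcases hx.lt_or_eq with h | h
  · rw [nested, if_pos h]
  · have h1 := third_le_leftEnd (w 0)
    have h2 := ratio_pos (w 0).pos
    have h3 : leftEnd (w 0) ≤ drop (w 0) := le_max_left _ _
    rw [nested, if_neg h.not_lt, if_pos (by linarith), h, sub_self, zero_div,
      nested_of_nonpos _ _ le_rfl, div_mul_cancel₀ _ (by linarith),
      min_eq_right (by linarith)]
    ring

theorem nested_succ_of_mem (n : ℕ) (w : ℕ → Fin N) {x : ℝ} (hx : leftEnd (w 0) ≤ x)
    (hx' : x ≤ leftEnd (w 0) + ratio N) :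
    nested (n + 1) w x = 1 - drop (w 0) +
      ratio N * (nested n (fun k => w (k + 1)) ((x - leftEnd (w 0)) / ratio N) - 1) := by
  rw [nested, if_neg hx.not_gt, if_pos hx']

theorem nested_succ_of_ge (n : ℕ) (w : ℕ → Fin N) {x : ℝ}
    (hx : leftEnd (w 0) + ratio N ≤ x) :
    nested (n + 1) w x = min x (1 - drop (w 0) / rightGap (w 0) * (1 - x)) := by
  have h2 := ratio_pos (w 0).pos
  rcases hx.lt_or_eq with h | h
  · rw [nested, if_neg (by linarith), if_neg h.not_ge]
  · have h1 := third_le_rightGap (w 0)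
    have h3 := leftEnd_add_rightGap (w 0)
    have h4 : 1 - x = rightGap (w 0) := by linarith
    have h5 : rightGap (w 0) ≤ drop (w 0) := le_max_right _ _
    rw [nested_succ_of_mem n w (by linarith) h.ge, h4, div_mul_cancel₀ _ (by linarith),
      ← h, add_sub_cancel_left, div_self h2.ne', nested_of_one_le _ _ le_rfl,
      min_eq_right (by linarith)]
    ring

/-! ### Slopes and positivity -/

theorem steepDecrOn_nested (hN : 0 < N) (n : ℕ) (w : ℕ → Fin N) :
    SteepDecrOn (nested n w) (Set.Iic (nestedMin n w)) := by
  induction n generalizing w with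
  | zero =>
    intro x hx y hy hxy
    simp only [nestedMin, cellLeft, pow_zero, Set.mem_Iic] at hx hy
    rw [nested, nested, max_eq_left (by linarith), max_eq_left (by linarith)]
    constructor <;> linarith
  | succ n ih =>
    have hr := ratio_pos hN
    have hc := nestedMin_mem_Ioo hN n fun k => w (k + 1)
    have hc' := nestedMin_succ n w
    have hc0 := mul_pos hr hc.1
    have hc1 := mul_lt_mul_of_pos_left hc.2 hr
    refine SteepDecrOn.glue (m := leftEnd (w 0)) (s := Set.Iic (leftEnd (w 0)))
      (t := Set.Icc (leftEnd (w 0)) (nestedMin (n + 1) w)) ?_ ?_ Set.self_mem_Iic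
      ⟨le_rfl, by linarith⟩ (fun x _ h => h) (fun x h h' => ⟨h', h⟩)
    · intro x hx y hy hxy
      obtain ⟨h1, h2⟩ := drop_div_mem (Or.inl rfl : leftEnd (w 0) = leftEnd (w 0) ∨ _)
      rw [nested_succ_of_le_leftEnd n w hx, nested_succ_of_le_leftEnd n w hy]
      have h3 := mul_le_mul_of_nonneg_right h1 (sub_nonneg.2 hxy)
      have h4 := mul_le_mul_of_nonneg_right h2 (sub_nonneg.2 hxy)
      constructor
      · rcases min_choice (1 - x) (1 - drop (w 0) / leftEnd (w 0) * x) with h | h <;> rw [h]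
        · linarith [min_le_left (1 - y) (1 - drop (w 0) / leftEnd (w 0) * y)]
        · linarith [min_le_right (1 - y) (1 - drop (w 0) / leftEnd (w 0) * y)]
      · rcases min_choice (1 - y) (1 - drop (w 0) / leftEnd (w 0) * y) with h | h <;> rw [h]
        · linarith [min_le_left (1 - x) (1 - drop (w 0) / leftEnd (w 0) * x)]
        · linarith [min_le_right (1 - x) (1 - drop (w 0) / leftEnd (w 0) * x)]
    · intro x hx y hy hxy
      rw [nested_succ_of_mem n w hx.1 (by linarith [hx.2]),
        nested_succ_of_mem n w hy.1 (by linarith [hy.2])]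
      obtain ⟨h1, h2⟩ := ih (fun k => w (k + 1)) ((x - leftEnd (w 0)) / ratio N)
        (by rw [Set.mem_Iic, div_le_iff₀ hr]; linarith [hx.2])
        ((y - leftEnd (w 0)) / ratio N)
        (by rw [Set.mem_Iic, div_le_iff₀ hr]; linarith [hy.2])
        (by gcongr)
      have h3 : ratio N * ((y - leftEnd (w 0)) / ratio N - (x - leftEnd (w 0)) / ratio N) =
        y - x := by field_simp; ring
      have h4 := mul_le_mul_of_nonneg_left h1 hr.le
      have h5 := mul_le_mul_of_nonneg_left h2 hr.le
      constructor <;> linarith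

theorem steepIncrOn_nested (hN : 0 < N) (n : ℕ) (w : ℕ → Fin N) :
    SteepIncrOn (nested n w) (Set.Ici (nestedMin n w)) := by
  induction n generalizing w with
  | zero =>
    intro x hx y hy hxy
    simp only [nestedMin, cellLeft, pow_zero, Set.mem_Ici] at hx hy
    rw [nested, nested, max_eq_right (by linarith), max_eq_right (by linarith)]
    constructor <;> linarith
  | succ n ih =>
    have hr := ratio_pos hN
    have hc := nestedMin_mem_Ioo hN n fun k => w (k + 1)
    have hc' := nestedMin_succ n w
    have hc0 := mul_pos hr hc.1
    have hc1 := mul_lt_mul_of_pos_left hc.2 hr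
    refine SteepIncrOn.glue (m := leftEnd (w 0) + ratio N)
      (s := Set.Icc (nestedMin (n + 1) w) (leftEnd (w 0) + ratio N))
      (t := Set.Ici (leftEnd (w 0) + ratio N)) ?_ ?_ ⟨by linarith, le_rfl⟩ Set.self_mem_Ici
      (fun x h h' => ⟨h, h'⟩) (fun x _ h => h)
    · intro x hx y hy hxy
      rw [nested_succ_of_mem n w (by linarith [hx.1]) hx.2,
        nested_succ_of_mem n w (by linarith [hy.1]) hy.2]
      obtain ⟨h1, h2⟩ := ih (fun k => w (k + 1)) ((x - leftEnd (w 0)) / ratio N)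
        (by rw [Set.mem_Ici, le_div_iff₀ hr]; linarith [hx.1])
        ((y - leftEnd (w 0)) / ratio N)
        (by rw [Set.mem_Ici, le_div_iff₀ hr]; linarith [hy.1])
        (by gcongr)
      have h3 : ratio N * ((y - leftEnd (w 0)) / ratio N - (x - leftEnd (w 0)) / ratio N) =
        y - x := by field_simp; ring
      have h4 := mul_le_mul_of_nonneg_left h1 hr.le
      have h5 := mul_le_mul_of_nonneg_left h2 hr.le
      constructor <;> linarith
    · intro x hx y hy hxy
      obtain ⟨h1, h2⟩ := drop_div_mem (Or.inr rfl : rightGap (w 0) = leftEnd (w 0) ∨ _)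
      rw [nested_succ_of_ge n w hx, nested_succ_of_ge n w hy]
      have h3 := mul_le_mul_of_nonneg_right h1 (sub_nonneg.2 hxy)
      have h4 := mul_le_mul_of_nonneg_right h2 (sub_nonneg.2 hxy)
      constructor
      · rcases min_choice y (1 - drop (w 0) / rightGap (w 0) * (1 - y)) with h | h <;> rw [h]
        · linarith [min_le_left x (1 - drop (w 0) / rightGap (w 0) * (1 - x))]
        · linarith [min_le_right x (1 - drop (w 0) / rightGap (w 0) * (1 - x))]
      · rcases min_choice x (1 - drop (w 0) / rightGap (w 0) * (1 - x)) with h | h <;> rw [h]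
        · linarith [min_le_left y (1 - drop (w 0) / rightGap (w 0) * (1 - y))]
        · linarith [min_le_right y (1 - drop (w 0) / rightGap (w 0) * (1 - y))]

theorem nested_nestedMin_nonneg (hN : 0 < N) (n : ℕ) (w : ℕ → Fin N) :
    0 ≤ nested n w (nestedMin n w) := by
  induction n generalizing w with
  | zero => exact le_max_of_le_right (nestedMin_mem_Ioo hN 0 w).1.le
  | succ n ih =>
    have hr := ratio_pos hN
    have hc := nestedMin_mem_Ioo hN n fun k => w (k + 1)
    have h1 := mul_pos hr hc.1
    have h2 := mul_lt_mul_of_pos_left hc.2 hr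
    have h3 := mul_nonneg hr.le (ih fun k => w (k + 1))
    -- The inner copy falls by at most `ratio N` below its level `1 - drop (w 0)` at the ends.
    have h4 : drop (w 0) ≤ 1 - ratio N := by
      have h5 := third_le_leftEnd (w 0)
      have h6 := third_le_rightGap (w 0)
      have h7 := leftEnd_add_rightGap (w 0)
      exact max_le (by linarith) (by linarith)
    rw [nestedMin_succ, nested_succ_of_mem n w (by linarith) (by linarith),
      add_sub_cancel_left, mul_div_cancel_left₀ _ hr.ne']
    linarith

theorem nested_nonneg (hN : 0 < N) (n : ℕ) (w : ℕ → Fin N) (x : ℝ) : 0 ≤ nested n w x := by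
  have h0 := nested_nestedMin_nonneg hN n w
  rcases eq_or_ne x (nestedMin n w) with rfl | hx
  · exact h0
  · exact h0.trans (lt_of_steep (steepDecrOn_nested hN n w) (steepIncrOn_nested hN n w) hx).le

/-! ### Locality and disjointness of cells -/

theorem nested_eq_of_notMem_cell (hN : 0 < N) {k n : ℕ} (hk : k ≤ n) {w w' : ℕ → Fin N}
    (hw : ∀ i < k, w i = w' i) {x : ℝ} (hx : x ∉ cell k w) : nested n w x = nested n w' x := by
  induction k generalizing n w w' x with
  | zero =>
    simp only [cell, cellLeft, pow_zero, zero_add, Set.mem_Icc, not_and_or, not_le] at hx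
    rcases hx with h | h
    · rw [nested_of_nonpos _ _ h.le, nested_of_nonpos _ _ h.le]
    · rw [nested_of_one_le _ _ h.le, nested_of_one_le _ _ h.le]
  | succ k ih =>
    obtain ⟨n, rfl⟩ : ∃ m, n = m + 1 := ⟨n - 1, by omega⟩
    have hr := ratio_pos hN
    -- This holds in all three branches, since leaving a cell is preserved by rescaling; no case
    -- split on `x` is needed.
    have hin : nested n (fun j => w (j + 1)) ((x - leftEnd (w 0)) / ratio N) =
        nested n (fun j => w' (j + 1)) ((x - leftEnd (w 0)) / ratio N) := by
      refine ih (by omega) (fun i hi => hw (i + 1) (by omega)) fun hmem => hx ?_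
      rw [cell, Set.mem_Icc, le_div_iff₀ hr, div_le_iff₀ hr] at hmem
      rw [cell, Set.mem_Icc, cellLeft, pow_succ]
      constructor <;> linarith [hmem.1, hmem.2]
    rw [nested, nested, hin, hw 0 (by omega)]

theorem cell_succ_subset (hN : 0 < N) (k : ℕ) (w : ℕ → Fin N) : cell (k + 1) w ⊆ cell k w := by
  have key : cellLeft k w ≤ cellLeft (k + 1) w ∧
      cellLeft (k + 1) w + ratio N ^ (k + 1) ≤ cellLeft k w + ratio N ^ k := by
    induction k generalizing w with
    | zero => simpa [cellLeft] using cellLeft_bounds hN 1 w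
    | succ k ih =>
      have hr := ratio_pos hN
      obtain ⟨h1, h2⟩ := ih fun j => w (j + 1)
      have h3 := mul_le_mul_of_nonneg_left h1 hr.le
      have h4 := mul_le_mul_of_nonneg_left h2 hr.le
      have hsucc : ∀ m, cellLeft (m + 1) w =
          leftEnd (w 0) + ratio N * cellLeft m fun j => w (j + 1) := fun _ => rfl
      rw [hsucc, hsucc, pow_succ _ (k + 1), pow_succ _ k]
      rw [pow_succ _ k] at h4
      constructor <;> linarith
  exact Set.Icc_subset_Icc key.1 key.2

theorem cell_anti (hN : 0 < N) (w : ℕ → Fin N) : Antitone fun k => cell k w :=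
  antitone_nat_of_succ_le fun k => cell_succ_subset hN k w

theorem eq_of_mem_cell_succ (hN : 0 < N) {k : ℕ} {w w' : ℕ → Fin N}
    (hw : ∀ i < k, w i = w' i) {x : ℝ} (hx : x ∈ cell (k + 1) w) (hx' : x ∈ cell (k + 1) w') :
    w k = w' k := by
  have hr := ratio_pos hN
  induction k generalizing w w' x with
  | zero =>
    simp only [cell, cellLeft, leftEnd, Set.mem_Icc, mul_zero, add_zero, zero_add, pow_one]
      at hx hx'
    -- Consecutive left ends are `2 * ratio N` apart, the intervals only `ratio N` long.
    have h1 : (w 0 : ℝ) < w' 0 + 1 := by nlinarith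
    have h2 : (w' 0 : ℝ) < w 0 + 1 := by nlinarith
    norm_cast at h1 h2
    exact Fin.ext (by omega)
  | succ k ih =>
    have key : ∀ v : ℕ → Fin N, x ∈ cell (k + 2) v →
        (x - leftEnd (v 0)) / ratio N ∈ cell (k + 1) fun j => v (j + 1) := by
      intro v hv
      rw [cell, Set.mem_Icc, cellLeft, pow_succ] at hv
      rw [cell, Set.mem_Icc, le_div_iff₀ hr, div_le_iff₀ hr]
      constructor <;> linarith [hv.1, hv.2]
    have h' := key w' hx'
    rw [← hw 0 (by omega)] at h'
    exact ih (fun i hi => hw (i + 1) (by omega)) (key w hx) h'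

theorem mem_cell_of_abs_sub_lt {n : ℕ} {w : ℕ → Fin N} {x : ℝ}
    (hx : |x - nestedMin n w| < ratio N ^ n / 2) : x ∈ cell n w := by
  rw [abs_lt, nestedMin] at hx
  constructor <;> linarith [hx.1, hx.2]

theorem nested_eventuallyEq (hN : 0 < N) {k n : ℕ} (hk : k ≤ n) {w w' : ℕ → Fin N}
    (hw : ∀ i < k, w i = w' i) {x : ℝ} (hx : x ∉ cell k w) :
    nested n w =ᶠ[𝓝 x] nested n w' :=
  Filter.eventuallyEq_of_mem (isClosed_Icc.isOpen_compl.mem_nhds hx) fun _ hy =>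
    nested_eq_of_notMem_cell hN hk hw hy

/-! ### Counting the words that are hit -/

/-- As long as the queries stay out of the successive cells, they reveal at most one letter each. -/
theorem iterates_nested_eq (hN : 0 < N) {R : Type*} {O : (ℝ → ℝ) → ℝ → R} (hO : IsLocalOracle O)
    (A : (t : ℕ) → (Fin t → R) → ℝ) {n t : ℕ} (ht : t ≤ n) {w w' : ℕ → Fin N}
    (hw : ∀ i < t, w i = w' i)
    (hout : ∀ s < t, iterates O A (nested n w) s ∉ cell (s + 1) w) :
    iterates O A (nested n w) t = iterates O A (nested n w') t := by
  induction t using Nat.strong_induction_on with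
  | _ t ih =>
    rw [iterates, iterates]
    congr 1
    funext s
    have hs := s.2
    rw [← ih s hs (by omega) (fun i hi => hw i (by omega)) fun j hj => hout j (by omega)]
    exact hO _ _ _ (nested_eventuallyEq hN (by omega) (fun i hi => hw i (by omega)) (hout s hs))

/-- A finite word, padded to an infinite one. -/
def padWord (hN : 0 < N) {T : ℕ} (w : Fin T → Fin N) (k : ℕ) : Fin N :=
  if h : k < T then w ⟨k, h⟩ else ⟨0, hN⟩

open Classical in
/-- A deterministic algorithm enters the cells of few of the functions in the family. -/
theorem card_mul_le (hN : 0 < N) {R : Type*} {O : (ℝ → ℝ) → ℝ → R} (hO : IsLocalOracle O)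
    (A : (t : ℕ) → (Fin t → R) → ℝ) (T : ℕ) :
    (Finset.univ.filter fun w : Fin T → Fin N =>
      ∃ t < T, iterates O A (nested T (padWord hN w)) t ∈ cell T (padWord hN w)).card * N ≤
      T * N ^ T := by
  set x : (Fin T → Fin N) → ℕ → ℝ := fun w => iterates O A (nested T (padWord hN w)) with hx
  -- Words sorted by the first time `t` at which a query enters the cell of depth `t + 1`.
  set B : ℕ → Finset (Fin T → Fin N) := fun t => Finset.univ.filter fun w =>
    x w t ∈ cell (t + 1) (padWord hN w) ∧ ∀ s < t, x w s ∉ cell (s + 1) (padWord hN w) with hB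
  have hsub : (Finset.univ.filter fun w : Fin T → Fin N =>
      ∃ t < T, x w t ∈ cell T (padWord hN w)) ⊆ (Finset.range T).biUnion B := by
    intro w hw
    obtain ⟨t, ht, hmem⟩ := (Finset.mem_filter.1 hw).2
    have hex : ∃ t, x w t ∈ cell (t + 1) (padWord hN w) := ⟨t, cell_anti hN _ ht hmem⟩
    refine Finset.mem_biUnion.2 ⟨Nat.find hex, Finset.mem_range.2 ?_, Finset.mem_filter.2
      ⟨Finset.mem_univ _, Nat.find_spec hex, fun s hs => Nat.find_min hex hs⟩⟩
    exact (Nat.find_min' hex (cell_anti hN _ ht hmem)).trans_lt ht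
  have hcard : ∀ t ∈ Finset.range T, (B t).card * N ≤ N ^ T := by
    intro t ht
    rw [Finset.mem_range] at ht
    -- Overwriting letter `t` loses nothing: the other letters determine query `t`, whose position
    -- in the cell recovers the letter.
    have hinj : Set.InjOn (fun q : (Fin T → Fin N) × Fin N => Function.update q.1 ⟨t, ht⟩ q.2)
        ((B t ×ˢ Finset.univ : Finset ((Fin T → Fin N) × Fin N)) : Set _) := by
      rintro ⟨w, i⟩ hw ⟨w', i'⟩ hw' heq
      simp only [Finset.coe_product, Set.mem_prod, Finset.mem_coe, hB, Finset.mem_filter] at hw hw'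
      have hi : i = i' := by simpa using congrFun heq ⟨t, ht⟩
      have hne : ∀ j, j ≠ ⟨t, ht⟩ → w j = w' j := fun j hj => by
        simpa [Function.update_of_ne hj] using congrFun heq j
      have hpad : ∀ j < t, padWord hN w j = padWord hN w' j := fun j hj => by
        have hjT : j < T := hj.trans ht
        simp only [padWord, hjT, dif_pos]
        exact hne _ fun h => hj.ne (Fin.mk.inj_iff.1 h)
      have hxt : x w t = x w' t := iterates_nested_eq hN hO A ht.le hpad hw.1.2.2
      have hlast := eq_of_mem_cell_succ hN hpad hw.1.2.1 (hxt ▸ hw'.1.2.1)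
      simp only [padWord, ht, dif_pos] at hlast
      refine Prod.ext (funext fun j => ?_) hi
      rcases eq_or_ne j ⟨t, ht⟩ with rfl | hj
      · exact hlast
      · exact hne j hj
    have h := Finset.card_le_card_of_injOn _ (fun _ _ => Finset.mem_univ _) hinj
    simpa [Finset.card_product] using h
  calc _ ≤ ((Finset.range T).biUnion B).card * N :=
        Nat.mul_le_mul_right _ (Finset.card_le_card hsub)
    _ ≤ (∑ t ∈ Finset.range T, (B t).card) * N := Nat.mul_le_mul_right _ Finset.card_biUnion_le
    _ = ∑ t ∈ Finset.range T, (B t).card * N := Finset.sum_mul _ _ _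
    _ ≤ ∑ _t ∈ Finset.range T, N ^ T := Finset.sum_le_sum hcard
    _ = T * N ^ T := by simp

end NestedFamily

/-! ### Averaging over the seed and conclusion -/

open Classical in
/-- If every outcome lies in at most `b` of the events, then one of them has probability at most
`b` divided by the number of the events. -/
theorem exists_card_mul_measureReal_le {Ω ι : Type*} [MeasurableSpace Ω] [Fintype ι] [Nonempty ι]
    (μ : MeasureTheory.Measure Ω) [MeasureTheory.IsProbabilityMeasure μ] (E : ι → Set Ω)
    (hE : ∀ i, MeasureTheory.NullMeasurableSet (E i) μ) (b : ℝ)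
    (hb : ∀ ω, ((Finset.univ.filter fun i => ω ∈ E i).card : ℝ) ≤ b) :
    ∃ i, Fintype.card ι * μ.real (E i) ≤ b := by
  have hint : ∀ i, MeasureTheory.Integrable ((E i).indicator fun _ => (1 : ℝ)) μ := fun i =>
    (MeasureTheory.integrable_const 1).indicator₀ (hE i)
  have hsum : ∑ i, μ.real (E i) ≤ b := by
    calc ∑ i, μ.real (E i) = ∑ i, ∫ ω, (E i).indicator (fun _ => (1 : ℝ)) ω ∂μ := by
          refine Finset.sum_congr rfl fun i _ => ?_
          rw [MeasureTheory.integral_indicator₀ (hE i)]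
          simp
      _ = ∫ ω, ∑ i, (E i).indicator (fun _ => (1 : ℝ)) ω ∂μ :=
          (MeasureTheory.integral_finsetSum _ fun i _ => hint i).symm
      _ ≤ ∫ _, b ∂μ := by
          refine MeasureTheory.integral_mono (MeasureTheory.integrable_finsetSum _ fun i _ => hint i)
            (MeasureTheory.integrable_const b) fun ω => ?_
          simpa [Set.indicator_apply] using hb ω
      _ = b := by simp
  by_contra! h
  have hc : (0 : ℝ) < Fintype.card ι := by exact_mod_cast Fintype.card_pos
  have : ∑ _i : ι, b < ∑ i, Fintype.card ι * μ.real (E i) :=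
    Finset.sum_lt_sum_of_nonempty Finset.univ_nonempty fun i _ => h i
  rw [← Finset.mul_sum, Finset.sum_const, Finset.card_univ, nsmul_eq_mul] at this
  exact absurd (lt_of_mul_lt_mul_left this hc.le) hsum.not_gt

theorem mainTheorem6 (T : ℕ) (δ : ℝ) (hδ : 0 < δ) :
    ∃ ρ : ℝ, 0 < ρ ∧
      -- a local oracle with responses in an arbitrary set `R`
      ∀ {R : Type*} (O : (ℝ → ℝ) → ℝ → R), IsLocalOracle O →
      -- a randomized algorithm with its seed drawn from an arbitrary probability space `(Ω, μ)`
      ∀ {Ω : Type*} [MeasurableSpace Ω] (μ : MeasureTheory.Measure Ω)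
        [MeasureTheory.IsProbabilityMeasure μ] (A : (t : ℕ) → Ω → (Fin t → R) → ℝ),
      -- on every Lipschitz objective bounded from below, the iterates are random variables
      (∀ f : ℝ → ℝ, (∃ K, LipschitzWith K f) → BddBelow (Set.range f) →
        ∀ t < T, AEMeasurable (fun ω => iterates O (fun s => A s ω) f t) μ) →
      ∃ (h : ℝ → ℝ) (xstar : ℝ),
        (∀ x, 0 ≤ h x) ∧ LipschitzWith 2 h ∧ h 0 = 1 ∧
        xstar ∈ Set.Ioo (0 : ℝ) 1 ∧ (∀ x, x ≠ xstar → h xstar < h x) ∧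
        (∀ x, x ≠ xstar → ∀ g ∈ clarkeDeriv h x, 1 ≤ |g|) ∧
        μ.real {ω | ∃ t < T, |iterates O (fun s => A s ω) h t - xstar| < ρ} < δ := by
  classical
  -- This makes `T / N < δ`; the radius chosen below is half the length of a depth-`T` cell.
  obtain ⟨N, hTN⟩ := exists_nat_gt ((T : ℝ) / δ)
  have hN : 0 < N := by
    have : (0 : ℝ) < N := lt_of_le_of_lt (by positivity) hTN
    exact_mod_cast this
  have hNR : (0 : ℝ) < N := by exact_mod_cast hN
  refine ⟨ratio N ^ T / 2, half_pos (pow_pos (ratio_pos hN) T), ?_⟩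
  intro R O hO Ω _ μ _ A hA
  have : Nonempty (Fin T → Fin N) := ⟨fun _ => ⟨0, hN⟩⟩
  have hdec := fun w => steepDecrOn_nested hN T (padWord hN (T := T) w)
  have hinc := fun w => steepIncrOn_nested hN T (padWord hN (T := T) w)
  have hlip := fun w => lipschitzWith_two_of_steep (hdec w) (hinc w)
  obtain ⟨w, hw⟩ := exists_card_mul_measureReal_le μ
    (fun w : Fin T → Fin N => {ω | ∃ t < T, |iterates O (fun s => A s ω)
      (nested T (padWord hN w)) t - nestedMin T (padWord hN w)| < ratio N ^ T / 2})
    (fun w => by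
      have hset : {ω | ∃ t < T, |iterates O (fun s => A s ω) (nested T (padWord hN w)) t -
          nestedMin T (padWord hN w)| < ratio N ^ T / 2} = ⋃ t, ⋃ (_ : t < T),
          (fun ω => iterates O (fun s => A s ω) (nested T (padWord hN w)) t) ⁻¹'
            {x | |x - nestedMin T (padWord hN w)| < ratio N ^ T / 2} := by
        ext ω
        simp
      rw [hset]
      refine MeasureTheory.NullMeasurableSet.iUnion fun t =>
        MeasureTheory.NullMeasurableSet.iUnion fun ht => ?_
      refine (hA _ ⟨2, hlip w⟩ ⟨0, ?_⟩ t ht).nullMeasurableSet_preimage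
        (measurableSet_lt (by fun_prop) (by fun_prop))
      rintro _ ⟨x, rfl⟩
      exact nested_nonneg hN _ _ x)
    (T * N ^ T / N) (fun ω => by
      rw [le_div_iff₀ hNR]
      refine le_trans (mul_le_mul_of_nonneg_right (Nat.cast_le.2 (Finset.card_le_card ?_)) hNR.le)
        (by exact_mod_cast card_mul_le hN hO (fun s => A s ω) T)
      intro w hw
      simp only [Finset.mem_filter, Finset.mem_univ, true_and, Set.mem_ofPred_eq] at hw ⊢
      obtain ⟨t, ht, h⟩ := hw
      exact ⟨t, ht, mem_cell_of_abs_sub_lt h⟩)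
  refine ⟨nested T (padWord hN w), nestedMin T (padWord hN w), nested_nonneg hN _ _, hlip w,
    by rw [nested_of_nonpos _ _ le_rfl, sub_zero], nestedMin_mem_Ioo hN _ _,
    fun x hx => lt_of_steep (hdec w) (hinc w) hx,
    fun x hx g hg => one_le_abs_of_mem_clarkeDeriv (hdec w) (hinc w) hx hg, ?_⟩
  have hpow : (0 : ℝ) < N ^ T := by positivity
  rw [Fintype.card_fun, Fintype.card_fin, Fintype.card_fin, Nat.cast_pow, mul_comm (T : ℝ),
    mul_div_assoc] at hw
  refine (le_of_mul_le_mul_left hw hpow).trans_lt ?_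
  rw [div_lt_iff₀ hδ] at hTN
  rw [div_lt_iff₀ hNR]
  linarith
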